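/- Let $\alpha \ge -1$. For $\alpha > -1$ let $\mathfrak{B}_\alpha$ be the weighted Bergman space of analytic functions $f$ on the open unit disk $\mathbb{D}$ with $$\|f\|_\alpha^2 = (\alpha+1)\int_{\mathbb{D}} |f(z)|^2 (1-|z|^2)^\alpha \, dA(z) < \infty, \qquad dA = \frac{dx\,dy}{\pi},$$ and let $\mathfrak{B}_{-1} = H^2$ be the Hardy space of analytic functions $f(z)=\sum_{n\ge 0} a_n z^n$ on $\mathbb{D}$ with $\|f\|_{-1}^2=\sum_{n\ge 0} |a_n|^2<\infty$. Let $\varphi \colon \mathbb{D} \to \mathbb{D}$ be analytic and put $$[\varphi] = \sup_{z \in \mathbb{D}} \frac{|\varphi'(z)|\,(1-|z|^2)}{1-|\varphi(z)|^2}.$$ For a bounded operator $T$ and $n \ge 1$, let the entropy number $e_n(T)$ be the infimum of all $\varepsilon \geq 0$ such that the image under $T$ of the closed unit ball can be covered by at most $2^{n-1}$ closed balls of radius $\varepsilon$, and set $\gamma(T) = \liminf_{n\to\infty} [e_n(T)]^{1/n}$. Theorem. If the composition operator $T = C_\varphi \colon f \mapsto f \circ \varphi$ is compact on $\mathfrak{B}_\alpha$,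 then $$\gamma(T) \ge [\varphi]^{1/2}.$$ -/

import Mathlib

open Set Filter Topology MeasureTheory Metric
open scoped NNReal ENNReal

noncomputable section

namespace BergmanComp

/-- The open unit disk of the complex plane. -/
abbrev disk : Set ℂ := ball (0 : ℂ) 1

/-- The measure `dA_α = (α + 1) (1 - |z|²)^α dA` on the unit disk, where `dA = dx dy / π`. -/
def areaMeasure (α : ℝ) : Measure ℂ :=
  (volume.restrict disk).withDensity
    (fun z => ENNReal.ofReal ((α + 1) * (1 - ‖z‖ ^ 2) ^ α / Real.pi))

/-- The `n`-th Taylor coefficient of `f` at the origin. -/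
def taylorCoeff (f : ℂ → ℂ) (n : ℕ) : ℂ := iteratedDeriv n f 0 / (n.factorial : ℂ)

/-- The norm of `𝔅_α`, with values in `[0, ∞]`.  For `α > -1` it is
`(∫ |f|² dA_α)^{1/2}`; for `α = -1` it is the norm `(∑ |a_n|²)^{1/2}` of the Hardy space `H²`. -/
def enormB (α : ℝ) (f : ℂ → ℂ) : ℝ≥0∞ :=
  if α = -1 then eLpNorm (taylorCoeff f) 2 Measure.count
  else eLpNorm f 2 (areaMeasure α)

lemma taylorCoeff_add {f g : ℂ → ℂ} (hf : DifferentiableOn ℂ f disk)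
    (hg : DifferentiableOn ℂ g disk) : taylorCoeff (f + g) = taylorCoeff f + taylorCoeff g := by
  have h0 : disk ∈ 𝓝 (0 : ℂ) := ball_mem_nhds _ one_pos
  funext n
  have h1 : ContDiffAt ℂ n f 0 := (hf.analyticAt h0).contDiffAt
  have h2 : ContDiffAt ℂ n g 0 := (hg.analyticAt h0).contDiffAt
  simp only [taylorCoeff, Pi.add_apply, iteratedDeriv_add h1 h2, add_div]

lemma taylorCoeff_smul (c : ℂ) {f : ℂ → ℂ} (hf : DifferentiableOn ℂ f disk) :
    taylorCoeff (c • f) = c • taylorCoeff f := by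
  have h0 : disk ∈ 𝓝 (0 : ℂ) := ball_mem_nhds _ one_pos
  funext n
  have h1 : ContDiffAt ℂ n f 0 := (hf.analyticAt h0).contDiffAt
  have h2 : iteratedDeriv n (c • f) 0 = c • iteratedDeriv n f 0 :=
    iteratedDeriv_const_smul h1 c
  simp only [taylorCoeff, Pi.smul_apply, h2, smul_eq_mul, mul_div_assoc]

lemma aesm {α : ℝ} {f : ℂ → ℂ} (hf : DifferentiableOn ℂ f disk) :
    AEStronglyMeasurable f (areaMeasure α) :=
  (hf.continuousOn.aestronglyMeasurable isOpen_ball.measurableSet).mono_ac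
    (withDensity_absolutelyContinuous _ _)

lemma aesm_count (a : ℕ → ℂ) : AEStronglyMeasurable a Measure.count :=
  (measurable_of_countable a).aestronglyMeasurable

lemma enormB_add_le (α : ℝ) {f g : ℂ → ℂ} (hf : DifferentiableOn ℂ f disk)
    (hg : DifferentiableOn ℂ g disk) : enormB α (f + g) ≤ enormB α f + enormB α g := by
  unfold enormB
  split_ifs
  · rw [taylorCoeff_add hf hg]
    exact eLpNorm_add_le (aesm_count _) (aesm_count _) (by norm_num)
  · exact eLpNorm_add_le (aesm hf) (aesm hg) (by norm_num)

lemma enormB_smul (α : ℝ) (c : ℂ) {f : ℂ → ℂ} (hf : DifferentiableOn ℂ f disk) :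
    enormB α (c • f) = ‖c‖ₑ * enormB α f := by
  unfold enormB
  split_ifs
  · rw [taylorCoeff_smul c hf, eLpNorm_const_smul]
  · rw [eLpNorm_const_smul]

lemma enormB_zero (α : ℝ) : enormB α 0 = 0 := by
  have := enormB_smul α 0 (f := 0) (differentiableOn_const 0)
  simpa using this

lemma eq_zero_of_enormB_eq_zero {α : ℝ} (hα : -1 ≤ α) {f : ℂ → ℂ}
    (hf : DifferentiableOn ℂ f disk) (h : enormB α f = 0) : ∀ z ∈ disk, f z = 0 := by
  unfold enormB at h
  split_ifs at h with hc
  · rw [eLpNorm_eq_zero_iff (aesm_count _) (by norm_num)] at h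
    have h' : ∀ n, iteratedDeriv n f 0 = 0 := by
      intro n
      have := (Measure.ae_count_iff.1 h) n
      simpa [taylorCoeff, Nat.factorial_ne_zero] using this
    intro z hz
    have := Complex.hasSum_taylorSeries_on_ball (f := f) (c := 0) (r := 1) hf hz
    simp only [h', smul_zero] at this
    exact this.unique hasSum_zero
  · rw [eLpNorm_eq_zero_iff (aesm hf) (by norm_num)] at h
    have hα' : 0 < α + 1 := by
      rcases hα.lt_or_eq with h1 | h1
      · linarith
      · exact absurd h1.symm hc
    have hmeas : Measurable
        (fun z : ℂ => ENNReal.ofReal ((α + 1) * (1 - ‖z‖ ^ 2) ^ α / Real.pi)) := by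
      fun_prop
    rw [areaMeasure, Filter.EventuallyEq, ae_withDensity_iff hmeas] at h
    have h2 : f =ᵐ[volume.restrict disk] 0 := by
      filter_upwards [h, ae_restrict_mem isOpen_ball.measurableSet] with z h1 hz
      apply h1
      have hz' : ‖z‖ < 1 := by simpa using hz
      have : 0 < 1 - ‖z‖ ^ 2 := by nlinarith [norm_nonneg z]
      have : 0 < (α + 1) * (1 - ‖z‖ ^ 2) ^ α / Real.pi := by positivity
      simpa using this
    exact Measure.eqOn_open_of_ae_eq h2 isOpen_ball hf.continuousOn continuousOn_const

/-- The underlying vector space of `𝔅_α`: the analytic functions on the unit disk of finite norm.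
A function on the disk is represented by its extension by `0` to the plane. -/
def bergmanSubmodule (α : ℝ) : Submodule ℂ (ℂ → ℂ) where
  carrier := {f | DifferentiableOn ℂ f disk ∧ (∀ z, z ∉ disk → f z = 0) ∧ enormB α f < ∞}
  zero_mem' := ⟨differentiableOn_const 0, fun _ _ => rfl, by
    rw [enormB_zero]; exact ENNReal.zero_lt_top⟩
  add_mem' := by
    rintro f g ⟨hf, hf0, hfn⟩ ⟨hg, hg0, hgn⟩
    refine ⟨hf.add hg, fun z hz => by simp [hf0 z hz, hg0 z hz], ?_⟩
    exact (enormB_add_le α hf hg).trans_lt (ENNReal.add_lt_top.2 ⟨hfn, hgn⟩)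
  smul_mem' := by
    rintro c f ⟨hf, hf0, hfn⟩
    refine ⟨hf.const_smul c, fun z hz => by simp [hf0 z hz], ?_⟩
    rw [enormB_smul α c hf]
    exact ENNReal.mul_lt_top enorm_lt_top hfn

/-- The weighted Bergman space `𝔅_α` (`α > -1`), with `𝔅_{-1} = H²`. -/
def Bergman (α : ℝ) : Type := ↥(bergmanSubmodule α)

namespace Bergman

variable {α : ℝ}

instance : AddCommGroup (Bergman α) := inferInstanceAs (AddCommGroup ↥(bergmanSubmodule α))

instance : Module ℂ (Bergman α) := inferInstanceAs (Module ℂ ↥(bergmanSubmodule α))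

instance : CoeFun (Bergman α) (fun _ => ℂ → ℂ) := ⟨fun f => f.1⟩

instance : Norm (Bergman α) := ⟨fun f => (enormB α f).toReal⟩

lemma normedCore [hα : Fact (-1 ≤ α)] : NormedSpace.Core ℂ (Bergman α) where
  norm_nonneg _ := ENNReal.toReal_nonneg
  norm_smul c f := by
    change (enormB α (c • f.1)).toReal = ‖c‖ * (enormB α f.1).toReal
    rw [enormB_smul α c f.2.1, ENNReal.toReal_mul, toReal_enorm]
  norm_triangle f g := by
    change (enormB α (f.1 + g.1)).toReal ≤ (enormB α f.1).toReal + (enormB α g.1).toReal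
    rw [← ENNReal.toReal_add f.2.2.2.ne g.2.2.2.ne]
    exact ENNReal.toReal_mono (ENNReal.add_lt_top.2 ⟨f.2.2.2, g.2.2.2⟩).ne
      (enormB_add_le α f.2.1 g.2.1)
  norm_eq_zero_iff f := by
    constructor
    · intro h
      have h0 : enormB α f.1 = 0 :=
        ((ENNReal.toReal_eq_zero_iff _).1 h).resolve_right f.2.2.2.ne
      apply Subtype.ext
      funext z
      by_cases hz : z ∈ disk
      · exact eq_zero_of_enormB_eq_zero hα.out f.2.1 h0 z hz
      · exact f.2.2.1 z hz
    · rintro rfl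
      change (enormB α 0).toReal = 0
      rw [enormB_zero, ENNReal.toReal_zero]

instance [Fact (-1 ≤ α)] : NormedAddCommGroup (Bergman α) := NormedAddCommGroup.ofCore normedCore

instance [Fact (-1 ≤ α)] : NormedSpace ℂ (Bergman α) := NormedSpace.ofCore normedCore

end Bergman

/-- `T` is the composition operator `C_φ f = f ∘ φ` on `𝔅_α`. -/
def IsCompositionOperator {α : ℝ} [Fact (-1 ≤ α)] (φ : ℂ → ℂ)
    (T : Bergman α →L[ℂ] Bergman α) : Prop :=
  ∀ f : Bergman α, ∀ z ∈ disk, T f z = f (φ z)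

/-- The `n`-th (dyadic) entropy number `e_n(T)`, `n ≥ 1`: the infimum of all `ε ≥ 0` such that the
image of the closed unit ball is covered by at most `2 ^ (n - 1)` closed balls of radius `ε`. -/
def entropyNumber {E F : Type*} [NormedAddCommGroup E] [NormedSpace ℂ E]
    [NormedAddCommGroup F] [NormedSpace ℂ F] (T : E →L[ℂ] F) (n : ℕ) : ℝ≥0∞ :=
  ⨅ (ε : ℝ≥0) (_ : ∃ s : Finset F, s.card ≤ 2 ^ (n - 1) ∧
    T '' closedBall 0 1 ⊆ ⋃ y ∈ s, closedBall y (ε : ℝ)), (ε : ℝ≥0∞)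

/-- `γ(T) = liminf e_n(T)^{1/n}`. -/
def entropyGamma {E F : Type*} [NormedAddCommGroup E] [NormedSpace ℂ E]
    [NormedAddCommGroup F] [NormedSpace ℂ F] (T : E →L[ℂ] F) : ℝ≥0∞ :=
  liminf (fun n : ℕ => entropyNumber T n ^ (1 / (n : ℝ))) atTop

/-- The pseudo-hyperbolic derivative `φ^#(z) = |φ'(z)| (1 - |z|²) / (1 - |φ(z)|²)`. -/
def pseudoHypDeriv (φ : ℂ → ℂ) (z : ℂ) : ℝ :=
  ‖deriv φ z‖ * (1 - ‖z‖ ^ 2) / (1 - ‖φ z‖ ^ 2)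

/-- `[φ] = sup_{z ∈ 𝔻} φ^#(z)`. -/
def bracket (φ : ℂ → ℂ) : ℝ≥0∞ := ⨆ z ∈ disk, ENNReal.ofReal (pseudoHypDeriv φ z)

end BergmanComp

end

/-!
If `φ` is constant, then `[φ] = 0` and there is nothing to prove.  Otherwise `γ(C_φ) ≥ 1`, and the
Schwarz–Pick inequality gives `[φ] ≤ 1` (`bracket_le_one`).

The bound `γ(C_φ) ≥ 1` says that the entropy numbers of `C_φ` decay more slowly than any geometric
sequence; in fact `e_n(C_φ) ≥ c₀ c₁ ^ √n` up to rounding (`exists_le_entropyNumber`).  Choose `a` in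
the disk with `φ' a ≠ 0` and consider the polynomials of degree `< m` in `w - φ a` with coefficients
in `{0, …, 2 ^ m - 1}`.  There are `2 ^ (m²)` of them, and a common factor of exponential order in
`m` scales them into the unit ball.  If two of them first differ in the coefficient of
`(w - φ a) ^ k`, then the difference of their images under `C_φ` vanishes to order `k` at `a`, with
leading coefficient at least `|φ' a| ^ k` in modulus before scaling
(`norm_leadingCoeff_mul_pow_le`).  Since point evaluations are bounded on `𝔅_α` uniformly on
compact sets (`exists_norm_apply_le`), Cauchy's estimate for this coefficient
shows that the images are separated by a distance which is only exponentially small in `m`.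
By the pigeonhole principle (`le_entropyNumber_of_separated`) this distance
bounds `e_n(C_φ)` from below for all `n ≤ m²`, and `m` of the size of `√n` gives the claim.
-/

namespace BergmanComp

/-! ### The Schwarz–Pick inequality -/

lemma norm_sq_one_sub_conj_mul_sub (b w : ℂ) :
    ‖1 - (starRingEnd ℂ) b * w‖ ^ 2 - ‖w - b‖ ^ 2 = (1 - ‖b‖ ^ 2) * (1 - ‖w‖ ^ 2) := by
  simp only [Complex.sq_norm, Complex.normSq_apply, Complex.sub_re, Complex.sub_im,
    Complex.mul_re, Complex.mul_im, Complex.conj_re, Complex.conj_im, Complex.one_re,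
    Complex.one_im]
  ring

lemma one_sub_conj_mul_ne_zero {b w : ℂ} (hb : ‖b‖ < 1) (hw : ‖w‖ < 1) :
    1 - (starRingEnd ℂ) b * w ≠ 0 := by
  intro h
  have h1 : ‖(starRingEnd ℂ) b * w‖ = 1 := by
    rw [← sub_eq_zero.1 h, norm_one]
  rw [norm_mul, Complex.norm_conj] at h1
  nlinarith [norm_nonneg b, norm_nonneg w]

/-- The disk automorphism `w ↦ (w - b) / (1 - b̄ w)` maps the disk into itself. -/
lemma norm_mobius_lt_one {b w : ℂ} (hb : ‖b‖ < 1) (hw : ‖w‖ < 1) :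
    ‖(w - b) / (1 - (starRingEnd ℂ) b * w)‖ < 1 := by
  have h0 := norm_pos_iff.2 (one_sub_conj_mul_ne_zero hb hw)
  rw [norm_div, div_lt_one h0]
  refine lt_of_pow_lt_pow_left₀ 2 h0.le ?_
  have h1 := norm_sq_one_sub_conj_mul_sub b w
  have h2 : 0 < (1 - ‖b‖ ^ 2) * (1 - ‖w‖ ^ 2) := by
    apply mul_pos <;> nlinarith [norm_nonneg b, norm_nonneg w]
  linarith

lemma hasDerivAt_mobius {b w : ℂ} (hb : ‖b‖ < 1) (hw : ‖w‖ < 1) :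
    HasDerivAt (fun w => (w - b) / (1 - (starRingEnd ℂ) b * w))
      ((1 - (‖b‖ : ℂ) ^ 2) / (1 - (starRingEnd ℂ) b * w) ^ 2) w := by
  have h1 : HasDerivAt (fun w : ℂ => w - b) 1 w := (hasDerivAt_id w).sub_const b
  have h2 : HasDerivAt (fun w : ℂ => 1 - (starRingEnd ℂ) b * w) (-(starRingEnd ℂ) b) w := by
    simpa using ((hasDerivAt_id w).const_mul ((starRingEnd ℂ) b)).const_sub 1
  convert! h1.div h2 (one_sub_conj_mul_ne_zero hb hw) using 2
  rw [← Complex.conj_mul']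
  ring

/-- **Schwarz–Pick**: the pseudo-hyperbolic derivative of a self-map of the disk is at most `1`.
It is the derivative at `0` of the self-map `μ_b ∘ φ ∘ μ_{-a}` fixing `0`, where `b = φ a` and
`μ_b w = (w - b) / (1 - b̄ w)`, so the Schwarz lemma applies. -/
lemma pseudoHypDeriv_le_one {φ : ℂ → ℂ} (hφ : DifferentiableOn ℂ φ disk)
    (hmaps : MapsTo φ disk disk) {a : ℂ} (ha : a ∈ disk) : pseudoHypDeriv φ a ≤ 1 := by
  have ha' : ‖a‖ < 1 := by simpa using ha
  have hna : ‖-a‖ < 1 := by simpa using ha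
  have hb : ‖φ a‖ < 1 := by simpa using hmaps ha
  set b := φ a with hbdef
  set σ : ℂ → ℂ := fun w => (w - -a) / (1 - (starRingEnd ℂ) (-a) * w) with hσ
  set τ : ℂ → ℂ := fun w => (w - b) / (1 - (starRingEnd ℂ) b * w) with hτ
  have hσm : MapsTo σ disk disk := fun w hw => by
    have hw' : ‖w‖ < 1 := by simpa using hw
    exact mem_ball_zero_iff.2 (norm_mobius_lt_one hna hw')
  have hτm : MapsTo τ disk disk := fun w hw => by
    have hw' : ‖w‖ < 1 := by simpa using hw
    exact mem_ball_zero_iff.2 (norm_mobius_lt_one hb hw')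
  have hσd : DifferentiableOn ℂ σ disk := fun w hw =>
    (hasDerivAt_mobius hna (by simpa using hw)).differentiableAt.differentiableWithinAt
  have hτd : DifferentiableOn ℂ τ disk := fun w hw =>
    (hasDerivAt_mobius hb (by simpa using hw)).differentiableAt.differentiableWithinAt
  have hσ0 : σ 0 = a := by simp [hσ]
  have hd : DifferentiableOn ℂ (τ ∘ φ ∘ σ) disk :=
    hτd.comp (hφ.comp hσd hσm) (hmaps.comp hσm)
  have hm : MapsTo (τ ∘ φ ∘ σ) disk (closedBall ((τ ∘ φ ∘ σ) 0) 1) := by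
    have h0 : (τ ∘ φ ∘ σ) 0 = 0 := by simp [hσ0, ← hbdef, hτ]
    rw [h0]
    exact fun w hw => ball_subset_closedBall (hτm (hmaps (hσm hw)))
  have key := Complex.norm_deriv_le_one_of_mapsTo_ball hd hm one_pos
  have h1 : HasDerivAt σ (1 - (‖a‖ : ℂ) ^ 2) 0 := by
    simpa [hσ] using hasDerivAt_mobius hna (w := 0) (by simp)
  have h2 : HasDerivAt φ (deriv φ a) (σ 0) := by
    rw [hσ0]
    exact (hφ.differentiableAt (isOpen_ball.mem_nhds ha)).hasDerivAt
  have hsub : (1 : ℂ) - (‖b‖ : ℂ) ^ 2 ≠ 0 := by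
    have := one_sub_conj_mul_ne_zero hb hb
    rwa [Complex.conj_mul'] at this
  have h3 : HasDerivAt τ (1 / (1 - (‖b‖ : ℂ) ^ 2)) ((φ ∘ σ) 0) := by
    have := hasDerivAt_mobius hb hb
    rw [Complex.conj_mul'] at this
    rw [Function.comp_apply, hσ0, ← hbdef]
    convert! this using 1
    field_simp
  rw [(h3.comp 0 (h2.comp 0 h1)).deriv] at key
  have hreal : ∀ x : ℂ, ‖x‖ < 1 → ‖(1 : ℂ) - (‖x‖ : ℂ) ^ 2‖ = 1 - ‖x‖ ^ 2 := fun x hx => by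
    have : (0 : ℝ) ≤ 1 - ‖x‖ ^ 2 := by nlinarith [norm_nonneg x]
    rw [← Complex.norm_of_nonneg this]
    push_cast
    rfl
  rw [norm_mul, norm_mul, norm_div, norm_one, hreal a ha', hreal b hb] at key
  unfold pseudoHypDeriv
  rw [← hbdef]
  calc _ = 1 / (1 - ‖b‖ ^ 2) * (‖deriv φ a‖ * (1 - ‖a‖ ^ 2)) := by ring
    _ ≤ 1 := key

lemma bracket_le_one {φ : ℂ → ℂ} (hφ : DifferentiableOn ℂ φ disk)
    (hmaps : MapsTo φ disk disk) : bracket φ ≤ 1 :=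
  iSup₂_le fun _ hz => ENNReal.ofReal_le_one.2 (pseudoHypDeriv_le_one hφ hmaps hz)

lemma exists_deriv_ne_zero_of_bracket_ne_zero {φ : ℂ → ℂ} (h : bracket φ ≠ 0) :
    ∃ a ∈ disk, deriv φ a ≠ 0 := by
  by_contra! hd
  refine h (ENNReal.iSup_eq_zero.2 fun a => ENNReal.iSup_eq_zero.2 fun ha => ?_)
  simp [pseudoHypDeriv, hd a ha]

/-! ### Functions bounded on a larger disk belong to the Bergman space -/

lemma integrableOn_one_sub_norm_sq_rpow {α : ℝ} (hα : -1 < α) :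
    IntegrableOn (fun z : ℂ => (1 - ‖z‖ ^ 2) ^ α) disk := by
  rw [integrableOn_fun_norm_addHaar (f := fun y : ℝ => (1 - y ^ 2) ^ α) volume]
  have h1 : IntervalIntegrable (fun y : ℝ => (1 - y) ^ α) volume 0 1 := by
    have := intervalIntegral.intervalIntegrable_rpow' hα (a := 0) (b := 1)
    simpa using (this.comp_sub_left 1).symm
  have h2 : ContinuousOn (fun y : ℝ => y * (1 + y) ^ α) (uIcc 0 1) := by
    refine continuousOn_id.mul ((continuousOn_const.add continuousOn_id).rpow_const ?_)
    intro y hy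
    rw [uIcc_of_le zero_le_one] at hy
    have : 0 < 1 + y := by linarith [hy.1]
    exact Or.inl this.ne'
  have h3 := h1.mul_continuousOn h2
  rw [intervalIntegrable_iff_integrableOn_Ioo_of_le zero_le_one] at h3
  refine h3.congr_fun (fun y hy => ?_) measurableSet_Ioo
  have e1 : (1 : ℝ) - y ^ 2 = (1 - y) * (1 + y) := by ring
  simp only [Complex.finrank_real_complex, smul_eq_mul]
  rw [e1, Real.mul_rpow (by linarith [hy.2]) (by linarith [hy.1])]
  ring

lemma areaMeasure_univ_lt_top {α : ℝ} (hα : -1 < α) : areaMeasure α univ < ∞ := by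
  rw [areaMeasure, withDensity_apply _ MeasurableSet.univ, Measure.restrict_univ]
  have := ((integrableOn_one_sub_norm_sq_rpow hα).const_mul (α + 1)).div_const Real.pi
  exact this.lintegral_lt_top

lemma eLpNorm_two_geometric_lt_top :
    eLpNorm (fun n : ℕ => ((1 / 2 : ℝ)) ^ n) 2 Measure.count < ∞ := by
  rw [eLpNorm_lt_top_iff_lintegral_rpow_enorm_lt_top (by norm_num) (by norm_num), lintegral_count]
  have : ∀ n : ℕ, ‖((1 / 2 : ℝ)) ^ n‖ₑ ^ (ENNReal.toReal 2) = ENNReal.ofReal ((1 / 4) ^ n) := by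
    intro n
    rw [ENNReal.toReal_ofNat, ENNReal.rpow_ofNat, Real.enorm_of_nonneg (by positivity),
      ← ENNReal.ofReal_pow (by positivity), ← pow_mul, mul_comm, pow_mul]
    norm_num
  simp_rw [this]
  exact (summable_geometric_of_lt_one (by norm_num) (by norm_num)).tsum_ofReal_lt_top

/-- An entire function which is bounded by `M` on the disk of radius `2` has norm at most a constant
times `M`.  The larger disk serves the Hardy space, where Cauchy's estimates on it make the Taylor
coefficients at most `M / 2 ^ n`. -/
lemma exists_enormB_indicator_le {α : ℝ} (hα : -1 ≤ α) :
    ∃ K : ℝ, 0 < K ∧ ∀ f : ℂ → ℂ, Differentiable ℂ f → ∀ M : ℝ, 0 ≤ M →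
      (∀ z ∈ closedBall (0 : ℂ) 2, ‖f z‖ ≤ M) →
        enormB α (disk.indicator f) ≤ ENNReal.ofReal (K * M) := by
  -- It is enough to find a finite constant in `ℝ≥0∞`.
  suffices h : ∃ L : ℝ≥0∞, L < ∞ ∧ ∀ f : ℂ → ℂ, Differentiable ℂ f → ∀ M : ℝ, 0 ≤ M →
      (∀ z ∈ closedBall (0 : ℂ) 2, ‖f z‖ ≤ M) →
        enormB α (disk.indicator f) ≤ L * ENNReal.ofReal M by
    obtain ⟨L, hL, h⟩ := h
    refine ⟨L.toReal + 1, by positivity, fun f hf M hM hfM => (h f hf M hM hfM).trans ?_⟩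
    rw [ENNReal.ofReal_mul (by positivity)]
    gcongr
    rw [ENNReal.le_ofReal_iff_toReal_le hL.ne (by positivity)]
    linarith
  rcases hα.eq_or_lt with rfl | hα
  · refine ⟨_, eLpNorm_two_geometric_lt_top, fun f hf M hM hfM => ?_⟩
    rw [enormB, if_pos rfl]
    have hev : disk.indicator f =ᶠ[𝓝 0] f := by
      filter_upwards [ball_mem_nhds (0 : ℂ) one_pos] with z hz using indicator_of_mem hz f
    have hc : ∀ n, ‖taylorCoeff (disk.indicator f) n‖ ≤ ‖(M • fun n : ℕ => (1 / 2 : ℝ) ^ n) n‖ := by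
      intro n
      have := Complex.norm_iteratedDeriv_le_of_forall_mem_sphere_norm_le n (c := 0) (f := f)
        two_pos hf.diffContOnCl (fun z hz => hfM z (sphere_subset_closedBall hz))
      rw [taylorCoeff, hev.iteratedDeriv_eq n, norm_div, Complex.norm_natCast,
        div_le_iff₀ (by positivity)]
      rw [Pi.smul_apply, smul_eq_mul, Real.norm_of_nonneg (by positivity)]
      calc _ ≤ _ := this
        _ = _ := by rw [one_div, inv_pow]; ring
    calc _ ≤ eLpNorm (M • fun n : ℕ => (1 / 2 : ℝ) ^ n) 2 Measure.count := eLpNorm_mono hc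
      _ = _ := by rw [eLpNorm_const_smul, Real.enorm_of_nonneg hM, mul_comm]
  · have hfin : IsFiniteMeasure (areaMeasure α) := ⟨areaMeasure_univ_lt_top hα⟩
    refine ⟨areaMeasure α univ ^ (ENNReal.toReal 2)⁻¹,
      ENNReal.rpow_lt_top_of_nonneg (by positivity) (measure_ne_top _ _), fun f hf M hM hfM => ?_⟩
    rw [enormB, if_neg hα.ne']
    refine eLpNorm_le_of_ae_bound (Eventually.of_forall fun z => ?_)
    by_cases hz : z ∈ disk
    · rw [indicator_of_mem hz]
      exact hfM z (closedBall_subset_closedBall one_le_two (ball_subset_closedBall hz))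
    · rw [indicator_of_notMem hz, norm_zero]
      exact hM

/-! ### Boundedness of point evaluations -/

/-- The mean value inequality on circles, as a lower integral over `(-π, π)`. -/
lemma two_pi_mul_enorm_le_lintegral_circleMap {f : ℂ → ℂ} {c : ℂ} {r : ℝ} (hr : 0 < r)
    (hf : DiffContOnCl ℂ f (ball c r)) :
    ENNReal.ofReal (2 * Real.pi) * ‖f c‖ₑ
      ≤ ∫⁻ θ in Ioo (-Real.pi) Real.pi, ‖f (circleMap c r θ)‖ₑ := by
  have h1 : Real.circleAverage f c r = f c :=
    DiffContOnCl.circleAverage (by rwa [abs_of_pos hr])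
  have hper : Function.Periodic (fun θ => f (circleMap c r θ)) (2 * Real.pi) :=
    (periodic_circleMap c r).comp f
  have h2 := hper.intervalIntegral_add_eq 0 (-Real.pi)
  have e1 : (0 : ℝ) + 2 * Real.pi = 2 * Real.pi := by ring
  have e2 : -Real.pi + 2 * Real.pi = Real.pi := by ring
  rw [e1, e2, intervalIntegral.integral_of_le (by linarith [Real.pi_pos]) (a := -Real.pi),
    integral_Ioc_eq_integral_Ioo] at h2
  rw [Real.circleAverage, h2] at h1
  calc ENNReal.ofReal (2 * Real.pi) * ‖f c‖ₑ = ‖(2 * Real.pi) • f c‖ₑ := by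
        rw [enorm_smul, Real.enorm_of_nonneg (by positivity)]
    _ = ‖∫ θ in Ioo (-Real.pi) Real.pi, f (circleMap c r θ)‖ₑ := by
        rw [← h1, smul_smul, mul_inv_cancel₀ (by positivity), one_smul]
    _ ≤ _ := enorm_integral_le_lintegral_enorm _

lemma setLIntegral_ball_eq_polar (c : ℂ) (R : ℝ) {F : ℂ → ℝ≥0∞}
    (hF : ContinuousOn F (ball c R)) :
    ∫⁻ z in ball c R, F z = ∫⁻ r in Ioi (0 : ℝ), ∫⁻ θ in Ioo (-Real.pi) Real.pi,
      ENNReal.ofReal r * (ball c R).indicator F (circleMap c r θ) := by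
  classical
  have hmeas : Measurable ((ball c R).indicator F) := by
    rw [← piecewise_eq_indicator]
    exact hF.measurable_piecewise continuousOn_const measurableSet_ball
  have hpol : ∀ p : ℝ × ℝ, c + Complex.polarCoord.symm p = circleMap c p.1 p.2 := fun p => by
    rw [Complex.polarCoord_symm_apply, circleMap, Complex.exp_mul_I, Complex.ofReal_cos,
      Complex.ofReal_sin]
  rw [← lintegral_indicator measurableSet_ball,
    ← lintegral_add_left_eq_self _ c, ← Complex.lintegral_comp_polarCoord_symm]
  simp_rw [hpol, smul_eq_mul]
  rw [polarCoord_target, Measure.volume_eq_prod, ← Measure.prod_restrict, lintegral_prod]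
  refine Measurable.aemeasurable (Measurable.mul (by fun_prop) (hmeas.comp ?_))
  unfold circleMap
  fun_prop

/-- The mean value inequality on disks. -/
lemma volume_ball_mul_enorm_le {f : ℂ → ℂ} {c : ℂ} {R : ℝ} (hf : DifferentiableOn ℂ f (ball c R)) :
    volume (ball c R) * ‖f c‖ₑ ≤ ∫⁻ z in ball c R, ‖f z‖ₑ := by
  have h1 : volume (ball c R) * ‖f c‖ₑ = ∫⁻ _ in ball c R, ‖f c‖ₑ := by
    rw [setLIntegral_const, mul_comm]
  rw [h1, setLIntegral_ball_eq_polar c R continuousOn_const,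
    setLIntegral_ball_eq_polar c R hf.continuousOn.enorm]
  refine setLIntegral_mono' measurableSet_Ioi fun r hr => ?_
  have hr : 0 < r := hr
  rw [lintegral_const_mul' _ _ ENNReal.ofReal_ne_top,
    lintegral_const_mul' _ _ ENNReal.ofReal_ne_top]
  gcongr 1
  by_cases hrR : r < R
  · have hmem : ∀ θ, circleMap c r θ ∈ ball c R := fun θ => by
      rw [mem_ball, mem_sphere.1 (circleMap_mem_sphere c hr.le θ)]
      exact hrR
    simp_rw [indicator_of_mem (hmem _)]
    refine le_trans (le_of_eq ?_) (two_pi_mul_enorm_le_lintegral_circleMap hr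
      (DifferentiableOn.diffContOnCl_ball (U := ball c R) hf (closedBall_subset_ball hrR)))
    rw [setLIntegral_const, Real.volume_Ioo, mul_comm]
    ring_nf
  · have hmem : ∀ θ, circleMap c r θ ∉ ball c R := fun θ => by
      rwa [mem_ball, mem_sphere.1 (circleMap_mem_sphere c hr.le θ)]
    simp_rw [indicator_of_notMem (hmem _)]
    exact le_rfl

/-- On compact subsets of the disk the density of `areaMeasure α` is bounded below, whence the norm
of `L²(areaMeasure α)` dominates a multiple of that of the unweighted `L²` there. -/
lemma exists_smul_restrict_ball_le_areaMeasure {α : ℝ} (hα : -1 < α) {t : ℝ} (ht : t < 1) :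
    ∃ δ : ℝ, 0 < δ ∧ ∀ z R, ball z R ⊆ closedBall (0 : ℂ) t →
      ENNReal.ofReal δ • volume.restrict (ball z R) ≤ areaMeasure α := by
  have hpos : ∀ z ∈ closedBall (0 : ℂ) t, 0 < 1 - ‖z‖ ^ 2 := fun z hz => by
    have : ‖z‖ < 1 := (mem_closedBall_zero_iff.1 hz).trans_lt ht
    nlinarith [norm_nonneg z]
  have hcont : ContinuousOn (fun z : ℂ => (α + 1) * (1 - ‖z‖ ^ 2) ^ α / Real.pi)
      (closedBall 0 t) := by
    refine ContinuousOn.div_const (continuousOn_const.mul (ContinuousOn.rpow_const ?_ ?_)) _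
    · fun_prop
    · exact fun z hz => Or.inl (hpos z hz).ne'
  obtain ⟨δ, hδ, hle⟩ := (isCompact_closedBall (0 : ℂ) t).exists_forall_le' hcont (a := 0)
    (fun z hz => by
      have := Real.rpow_pos_of_pos (hpos z hz) α
      have : 0 < α + 1 := by linarith
      positivity)
  refine ⟨δ, hδ, fun z R hzR => ?_⟩
  rw [areaMeasure, ← withDensity_const]
  have hsub : ball z R ⊆ disk := hzR.trans (closedBall_subset_ball ht)
  calc (volume.restrict (ball z R)).withDensity (fun _ => ENNReal.ofReal δ)
      ≤ (volume.restrict (ball z R)).withDensity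
        (fun z => ENNReal.ofReal ((α + 1) * (1 - ‖z‖ ^ 2) ^ α / Real.pi)) := by
        refine withDensity_mono ?_
        filter_upwards [ae_restrict_mem measurableSet_ball] with w hw
        exact ENNReal.ofReal_le_ofReal (hle w (hzR hw))
    _ ≤ _ := by
        refine Measure.le_iff.2 fun s hs => ?_
        rw [withDensity_apply _ hs, withDensity_apply _ hs]
        exact lintegral_mono' (Measure.restrict_mono le_rfl (Measure.restrict_mono hsub le_rfl))
          le_rfl

/-- Point evaluations are bounded on `𝔅_α`, uniformly on compact subsets of the disk. -/
lemma exists_norm_apply_le {α : ℝ} [hα : Fact (-1 ≤ α)] {s : ℝ} (hs0 : 0 ≤ s) (hs : s < 1) :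
    ∃ C : ℝ, 0 < C ∧ ∀ f : Bergman α, ∀ z, ‖z‖ ≤ s → ‖f z‖ ≤ C * ‖f‖ := by
  -- It is enough to find a finite constant in `ℝ≥0∞`.
  suffices h : ∃ C : ℝ≥0∞, C < ∞ ∧ ∀ f : ℂ → ℂ, DifferentiableOn ℂ f disk → enormB α f < ∞ →
      ∀ z, ‖z‖ ≤ s → ‖f z‖ₑ ≤ C * enormB α f by
    obtain ⟨C, hC, h⟩ := h
    refine ⟨C.toReal + 1, by positivity, fun f z hz => ?_⟩
    have h1 := ENNReal.toReal_mono (ENNReal.mul_lt_top hC f.2.2.2).ne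
      (h f.1 f.2.1 f.2.2.2 z hz)
    rw [toReal_enorm, ENNReal.toReal_mul] at h1
    have h2 : 0 ≤ (enormB α f.1).toReal := ENNReal.toReal_nonneg
    calc ‖f z‖ ≤ C.toReal * (enormB α f.1).toReal := h1
      _ ≤ (C.toReal + 1) * (enormB α f.1).toReal := by nlinarith
  rcases hα.out.eq_or_lt with rfl | hα
  · refine ⟨ENNReal.ofReal (1 - s)⁻¹, ENNReal.ofReal_lt_top, fun f hf hfin z hz => ?_⟩
    rw [enormB, if_pos rfl] at hfin ⊢
    set N := eLpNorm (taylorCoeff f) 2 Measure.count with hN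
    have hcoef : ∀ n, ‖taylorCoeff f n‖ ≤ N.toReal := fun n => by
      rw [← toReal_enorm]
      exact ENNReal.toReal_mono hfin.ne (enorm_le_eLpNorm_count _ n (by norm_num))
    have hsum := Complex.hasSum_taylorSeries_on_ball (f := f) (c := 0) (r := 1) hf
      (z := z) (mem_ball_zero_iff.2 (hz.trans_lt hs))
    have hgeo : HasSum (fun n => s ^ n * N.toReal) ((1 - s)⁻¹ * N.toReal) :=
      (hasSum_geometric_of_lt_one hs0 hs).mul_right _
    have hb : ‖f z‖ ≤ (1 - s)⁻¹ * N.toReal := by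
      rw [← hsum.tsum_eq]
      refine tsum_of_norm_bounded hgeo fun n => ?_
      have : ((n.factorial : ℂ)⁻¹ • (z - 0) ^ n • iteratedDeriv n f 0)
          = z ^ n * taylorCoeff f n := by
        simp only [taylorCoeff, smul_eq_mul, sub_zero]
        ring
      rw [this, norm_mul, norm_pow]
      gcongr
      exact hcoef n
    rw [← ofReal_norm, ← ENNReal.ofReal_toReal hfin.ne,
      ← ENNReal.ofReal_mul (inv_nonneg.2 (by linarith))]
    exact ENNReal.ofReal_le_ofReal hb
  · obtain ⟨δ, hδ, hle⟩ := exists_smul_restrict_ball_le_areaMeasure hα (t := (1 + s) / 2)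
      (by linarith)
    have hRpos : 0 < (1 - s) / 2 := by linarith
    set V := volume (ball (0 : ℂ) ((1 - s) / 2)) with hV
    have hV0 : V ≠ 0 := (measure_ball_pos volume _ hRpos).ne'
    have hVt : V ≠ ∞ := measure_ball_lt_top.ne
    set D := ENNReal.ofReal δ ^ (1 / (2 : ℝ≥0∞)).toReal with hD
    have hD0 : D ≠ 0 := by
      rw [hD, Ne, ENNReal.rpow_eq_zero_iff]
      simp [hδ]
    have hDt : D ≠ ∞ := ENNReal.rpow_ne_top_of_nonneg (by positivity) ENNReal.ofReal_ne_top
    set W := V ^ (1 / ENNReal.toReal 1 - 1 / ENNReal.toReal 2) with hW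
    have hWt : W ≠ ∞ := ENNReal.rpow_ne_top_of_nonneg (by norm_num) hVt
    refine ⟨V⁻¹ * (D⁻¹ * W), ?_, fun f hf hfin z hz => ?_⟩
    · exact ENNReal.mul_lt_top (ENNReal.inv_lt_top.2 hV0.bot_lt)
        (ENNReal.mul_lt_top (ENNReal.inv_lt_top.2 hD0.bot_lt) hWt.lt_top)
    rw [enormB, if_neg hα.ne']
    have hsub : ball z ((1 - s) / 2) ⊆ closedBall (0 : ℂ) ((1 + s) / 2) :=
      ball_subset_closedBall.trans (closedBall_subset_closedBall' (by
        rw [dist_zero_right]; linarith))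
    have hsub' : ball z ((1 - s) / 2) ⊆ disk :=
      hsub.trans (closedBall_subset_ball (by linarith))
    have hVz : volume (ball z ((1 - s) / 2)) = V := Measure.addHaar_ball_center _ _ _
    have h1 := volume_ball_mul_enorm_le (hf.mono hsub')
    rw [← eLpNorm_one_eq_lintegral_enorm, hVz] at h1
    have h2 : eLpNorm f 1 (volume.restrict (ball z ((1 - s) / 2)))
        ≤ eLpNorm f 2 (volume.restrict (ball z ((1 - s) / 2))) * W := by
      have := eLpNorm_le_eLpNorm_mul_rpow_measure_univ (p := 1) (q := 2) (by norm_num)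
        (((hf.mono hsub').continuousOn).aestronglyMeasurable measurableSet_ball (μ := volume))
      rwa [Measure.restrict_apply_univ, hVz] at this
    have h3 : D * eLpNorm f 2 (volume.restrict (ball z ((1 - s) / 2)))
        ≤ eLpNorm f 2 (areaMeasure α) := by
      rw [hD, ← smul_eq_mul, ← eLpNorm_smul_measure_of_ne_top ENNReal.ofNat_ne_top]
      exact eLpNorm_mono_measure _ (hle z _ hsub)
    have h4 : eLpNorm f 2 (volume.restrict (ball z ((1 - s) / 2)))
        ≤ D⁻¹ * eLpNorm f 2 (areaMeasure α) := by
      rw [mul_comm, ← div_eq_mul_inv, ENNReal.le_div_iff_mul_le (.inl hD0) (.inl hDt), mul_comm]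
      exact h3
    have h5 : ‖f z‖ₑ ≤ V⁻¹ * eLpNorm f 1 (volume.restrict (ball z ((1 - s) / 2))) := by
      rw [mul_comm, ← div_eq_mul_inv, ENNReal.le_div_iff_mul_le (.inl hV0) (.inl hVt), mul_comm]
      exact h1
    calc ‖f z‖ₑ ≤ V⁻¹ * (D⁻¹ * eLpNorm f 2 (areaMeasure α) * W) := by
          refine h5.trans ?_
          gcongr
          refine h2.trans ?_
          gcongr
      _ = _ := by ring

/-! ### Shifted monomials in the Bergman space -/

lemma indicator_mem_bergmanSubmodule {α : ℝ} (hα : -1 ≤ α) {f : ℂ → ℂ} (hf : Differentiable ℂ f) :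
    disk.indicator f ∈ bergmanSubmodule α := by
  refine ⟨hf.differentiableOn.congr fun z hz => indicator_of_mem hz f,
    fun z hz => indicator_of_notMem hz f, ?_⟩
  obtain ⟨K, -, hK⟩ := exists_enormB_indicator_le hα
  obtain ⟨M, hM⟩ := (isCompact_closedBall (0 : ℂ) 2).exists_bound_of_continuousOn
    hf.continuous.continuousOn
  exact (hK f hf (max M 0) (le_max_right _ _) fun z hz =>
    (hM z hz).trans (le_max_left _ _)).trans_lt ENNReal.ofReal_lt_top

/-- The function `w ↦ (w - b) ^ k` as an element of `𝔅_α`. -/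
noncomputable def shiftedMonomial (α : ℝ) [hα : Fact (-1 ≤ α)] (b : ℂ) (k : ℕ) : Bergman α :=
  ⟨disk.indicator fun w => (w - b) ^ k,
    indicator_mem_bergmanSubmodule hα.out (by fun_prop)⟩

lemma shiftedMonomial_apply {α : ℝ} [Fact (-1 ≤ α)] (b : ℂ) (k : ℕ) {w : ℂ} (hw : w ∈ disk) :
    shiftedMonomial α b k w = (w - b) ^ k :=
  indicator_of_mem hw fun w => (w - b) ^ k

lemma exists_norm_shiftedMonomial_le (α : ℝ) [hα : Fact (-1 ≤ α)] :
    ∃ K : ℝ, 0 < K ∧ ∀ b ∈ disk, ∀ k, ‖shiftedMonomial α b k‖ ≤ K * 3 ^ k := by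
  obtain ⟨K, hK0, hK⟩ := exists_enormB_indicator_le hα.out
  refine ⟨K, hK0, fun b hb k => ?_⟩
  refine ENNReal.toReal_le_of_le_ofReal (by positivity)
    (hK (fun w => (w - b) ^ k) (by fun_prop) _ (by positivity) fun z hz => ?_)
  rw [norm_pow]
  gcongr
  have h1 : ‖b‖ < 1 := mem_ball_zero_iff.1 hb
  have h2 : ‖z‖ ≤ 2 := mem_closedBall_zero_iff.1 hz
  linarith [norm_sub_le z b]

/-- Evaluation at a point, as a linear functional. -/
def evalLinear (α : ℝ) (z : ℂ) : Bergman α →ₗ[ℂ] ℂ where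
  toFun f := f z
  map_add' _ _ := rfl
  map_smul' _ _ := rfl

/-! ### The triangular structure of the composition operator -/

/-- The operator `C_φ` is triangular with respect to orders of vanishing at `φ a` and at `a`: if
`h = ∑ d_j (w - φ a)^j` vanishes to order `k` at `φ a`, then `h ∘ φ` vanishes to order `k` at `a`
with leading coefficient `d_k (φ' a)^k`.  The bound is Cauchy's estimate for this coefficient,
which is the value at `a` of the analytic function `(h ∘ φ) / (z - a)^k`. -/
lemma norm_leadingCoeff_mul_pow_le {φ : ℂ → ℂ} (hφ : DifferentiableOn ℂ φ disk) {a : ℂ} {R : ℝ}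
    (hR : 0 < R) (hsub : closedBall a R ⊆ disk) {m : ℕ} (d : Fin m → ℂ) (k : Fin m)
    (hd : ∀ j < k, d j = 0) {M : ℝ}
    (hM : ∀ z ∈ sphere a R, ‖∑ j, d j * (φ z - φ a) ^ (j : ℕ)‖ ≤ M) :
    ‖d k‖ * (‖deriv φ a‖ * R) ^ (k : ℕ) ≤ M := by
  have ha : a ∈ disk := hsub (mem_closedBall_self hR.le)
  -- The exponent `j - k` is truncated only for `j < k`, where `d j = 0`.
  set G : ℂ → ℂ := fun z =>
    dslope φ a z ^ (k : ℕ) * ∑ j, d j * (φ z - φ a) ^ ((j : ℕ) - (k : ℕ)) with hG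
  have hGd : DifferentiableOn ℂ G disk := by
    have h1 : DifferentiableOn ℂ (dslope φ a) disk :=
      (Complex.differentiableOn_dslope (isOpen_ball.mem_nhds ha)).2 hφ
    refine (h1.pow _).mul (DifferentiableOn.fun_sum fun j _ => ?_)
    exact ((hφ.sub_const _).pow _).const_mul _
  have hGa : G a = deriv φ a ^ (k : ℕ) * d k := by
    rw [hG]
    simp only [dslope_same, sub_self]
    congr 1
    rw [Finset.sum_eq_single k]
    · simp
    · intro j _ hj
      rcases lt_or_gt_of_ne hj with h | h
      · rw [hd j h, zero_mul]
      · have : (j : ℕ) - (k : ℕ) ≠ 0 := Nat.sub_ne_zero_of_lt h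
        rw [zero_pow this, mul_zero]
    · simp
  have hGz : ∀ z, (z - a) ^ (k : ℕ) * G z = ∑ j, d j * (φ z - φ a) ^ (j : ℕ) := by
    intro z
    have h1 : (z - a) * dslope φ a z = φ z - φ a := sub_smul_dslope φ a z
    rw [hG]
    simp only
    rw [← mul_assoc, ← mul_pow, h1, Finset.mul_sum]
    refine Finset.sum_congr rfl fun j _ => ?_
    by_cases h : j < k
    · rw [hd j h]
      ring
    · have : (k : ℕ) ≤ j := not_lt.1 h
      rw [mul_left_comm, ← pow_add, Nat.add_sub_cancel' this]
  have hfr : ∀ z ∈ frontier (ball a R), ‖G z‖ ≤ M / R ^ (k : ℕ) := fun z hz => by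
    have hz' : z ∈ sphere a R := frontier_ball_subset_sphere hz
    have h1 := hM z hz'
    rw [← hGz z, norm_mul, norm_pow, mem_sphere_iff_norm.1 hz'] at h1
    rw [le_div_iff₀ (by positivity)]
    linarith
  have key := Complex.norm_le_of_forall_mem_frontier_norm_le isBounded_ball
    (DifferentiableOn.diffContOnCl_ball hGd hsub) hfr (subset_closure (mem_ball_self hR))
  rw [hGa, norm_mul, norm_pow, le_div_iff₀ (by positivity)] at key
  calc _ = _ := by rw [mul_pow]; ring
    _ ≤ M := key

/-! ### Lower bounds for entropy numbers -/

/-- More than `2 ^ (n - 1)` points of the unit ball whose images are `2η`-separated force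
`η ≤ e_n(T)`: two of the images lie in the same ball of any admissible covering. -/
lemma le_entropyNumber_of_separated {E F : Type*} [NormedAddCommGroup E] [NormedSpace ℂ E]
    [NormedAddCommGroup F] [NormedSpace ℂ F] (T : E →L[ℂ] F) {n : ℕ} {ι : Type*} [Fintype ι]
    (hcard : 2 ^ (n - 1) < Fintype.card ι) (x : ι → E) (hx : ∀ i, ‖x i‖ ≤ 1) {η : ℝ}
    (hη : ∀ i j, i ≠ j → 2 * η ≤ ‖T (x i) - T (x j)‖) :
    ENNReal.ofReal η ≤ entropyNumber T n := by
  refine le_iInf₂ fun ε hε => ?_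
  obtain ⟨s, hs, hcov⟩ := hε
  have hmem : ∀ i, ∃ y : s, T (x i) ∈ closedBall (y : F) (ε : ℝ) := fun i => by
    have := hcov (mem_image_of_mem T (mem_closedBall_zero_iff.2 (hx i)))
    obtain ⟨y, hy, hxy⟩ := mem_iUnion₂.1 this
    exact ⟨⟨y, hy⟩, hxy⟩
  choose y hy using hmem
  obtain ⟨i, j, hij, hyij⟩ := Fintype.exists_ne_map_eq_of_card_lt y
    (by rw [Fintype.card_coe]; exact hs.trans_lt hcard)
  have h1 := hy i
  have h2 := hy j
  rw [← hyij] at h2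
  have h3 := dist_triangle_right (T (x i)) (T (x j)) (y i : F)
  rw [mem_closedBall] at h1 h2
  rw [dist_eq_norm] at h3
  have h4 := hη i j hij
  rw [ENNReal.ofReal_le_iff_le_toReal ENNReal.coe_ne_top, ENNReal.coe_toReal]
  linarith

/-- If `φ` is not constant, then `e_n(C_φ)` decays at most exponentially in `√n`. -/
lemma exists_le_entropyNumber {α : ℝ} [Fact (-1 ≤ α)] {φ : ℂ → ℂ}
    (hφ : DifferentiableOn ℂ φ disk) (hmaps : MapsTo φ disk disk)
    {T : Bergman α →L[ℂ] Bergman α} (hT : IsCompositionOperator φ T) {a : ℂ} (ha : a ∈ disk)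
    (hda : deriv φ a ≠ 0) :
    ∃ c₀ c₁ : ℝ, 0 < c₀ ∧ 0 < c₁ ∧ ∀ m n : ℕ, 0 < n → n ≤ m ^ 2 →
      ENNReal.ofReal (c₀ * c₁ ^ m) ≤ entropyNumber T n := by
  have ha1 : ‖a‖ < 1 := mem_ball_zero_iff.1 ha
  set R := (1 - ‖a‖) / 2 with hRdef
  have hR : 0 < R := by linarith
  have hnorm : ∀ z ∈ closedBall a R, ‖z‖ ≤ (1 + ‖a‖) / 2 := fun z hz => by
    have := norm_le_of_mem_closedBall hz
    linarith
  have hsub : closedBall a R ⊆ disk := fun z hz =>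
    mem_ball_zero_iff.2 ((hnorm z hz).trans_lt (by linarith))
  obtain ⟨C, hC, hCle⟩ := exists_norm_apply_le (α := α) (s := (1 + ‖a‖) / 2)
    (by positivity) (by linarith)
  obtain ⟨K, hK, hKle⟩ := exists_norm_shiftedMonomial_le α
  set ρ := min 1 (‖deriv φ a‖ * R) with hρ
  have hρ0 : 0 < ρ := lt_min one_pos (mul_pos (norm_pos_iff.2 hda) hR)
  refine ⟨1 / (2 * C * K), ρ / 12, by positivity, by positivity, fun m n hn hnm => ?_⟩
  -- The separated family: polynomials of degree `< m` in `w - φ a` with coefficients in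
  -- `{0, …, 2 ^ m - 1}`, scaled into the unit ball.
  -- The factor `12 = 2 * 2 * 3` bounds the number of terms `m ≤ 2 ^ m`, the coefficients and the
  -- norms `K * 3 ^ j` of the monomials.
  set τ : ℝ := (K * 12 ^ m)⁻¹ with hτ
  have hτ0 : 0 < τ := by positivity
  set x : (Fin m → Fin (2 ^ m)) → Bergman α := fun c =>
    (τ : ℂ) • ∑ j, ((c j : ℕ) : ℂ) • shiftedMonomial α (φ a) j with hx
  refine le_entropyNumber_of_separated T ?_ x (fun c => ?_) (fun c c' hcc' => ?_)
  · rw [Fintype.card_fun, Fintype.card_fin, Fintype.card_fin, ← pow_mul]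
    exact Nat.pow_lt_pow_right one_lt_two (by rw [← sq]; omega)
  · rw [hx]
    simp only
    rw [norm_smul, Complex.norm_real, Real.norm_of_nonneg hτ0.le, hτ,
      inv_mul_le_iff₀ (by positivity), mul_one]
    calc ‖∑ j, ((c j : ℕ) : ℂ) • shiftedMonomial α (φ a) j‖
        ≤ ∑ _j : Fin m, (2 : ℝ) ^ m * (K * 3 ^ m) := by
          refine norm_sum_le_of_le _ fun j _ => ?_
          rw [norm_smul, Complex.norm_natCast]
          have h1 : ((c j : ℕ) : ℝ) ≤ 2 ^ m := by exact_mod_cast (c j).2.le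
          have h2 : (3 : ℝ) ^ (j : ℕ) ≤ 3 ^ m := pow_le_pow_right₀ (by norm_num) j.2.le
          have h3 := hKle (φ a) (hmaps ha) j
          gcongr
          exact h3.trans (by gcongr)
      _ = m * ((2 : ℝ) ^ m * (K * 3 ^ m)) := by simp
      _ ≤ 2 ^ m * ((2 : ℝ) ^ m * (K * 3 ^ m)) := by
          gcongr
          exact_mod_cast Nat.lt_two_pow_self.le
      _ = K * 12 ^ m := by
          rw [show (12 : ℝ) = 2 * 2 * 3 by norm_num, mul_pow, mul_pow]
          ring
  · have hex : ∃ k, c k ≠ c' k := Function.ne_iff.1 hcc'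
    -- The first coefficient in which the two polynomials differ.
    obtain ⟨k, hk, hmin⟩ := WellFounded.has_min (wellFounded_lt (α := Fin m))
      {k | c k ≠ c' k} hex
    set d : Fin m → ℂ := fun j => (τ : ℂ) * (((c j : ℕ) : ℂ) - ((c' j : ℕ) : ℂ)) with hd
    have hd0 : ∀ j < k, d j = 0 := fun j hj => by
      have : c j = c' j := by
        by_contra h
        exact hmin j h hj
      simp [hd, this]
    have hdk : τ ≤ ‖d k‖ := by
      have h1 : ((c k : ℕ) : ℤ) - ((c' k : ℕ) : ℤ) ≠ 0 := by
        intro h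
        exact hk (Fin.ext (by omega))
      have h2 : (1 : ℝ) ≤ ‖((((c k : ℕ) : ℤ) - ((c' k : ℕ) : ℤ) : ℤ) : ℂ)‖ := by
        rw [Complex.norm_intCast]
        exact_mod_cast Int.one_le_abs h1
      push_cast at h2
      rw [hd]
      simp only
      rw [norm_mul, Complex.norm_real, Real.norm_of_nonneg hτ0.le]
      exact le_mul_of_one_le_right hτ0.le h2
    have heval : ∀ z ∈ disk, (T (x c) - T (x c') : Bergman α) z
        = ∑ j, d j * (φ z - φ a) ^ (j : ℕ) := by
      intro z hz
      have h1 : ∀ c : Fin m → Fin (2 ^ m), x c (φ z)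
          = ∑ j, (τ : ℂ) * (((c j : ℕ) : ℂ) * (φ z - φ a) ^ (j : ℕ)) := by
        intro c
        change evalLinear α (φ z) (x c) = _
        rw [hx]
        simp only [map_smul, map_sum, smul_eq_mul, Finset.mul_sum]
        refine Finset.sum_congr rfl fun j _ => ?_
        rw [← shiftedMonomial_apply (α := α) (φ a) j (hmaps hz)]
        rfl
      change T (x c) z - T (x c') z = _
      rw [hT _ z hz, hT _ z hz, h1, h1, ← Finset.sum_sub_distrib]
      refine Finset.sum_congr rfl fun j _ => ?_
      rw [hd]
      ring
    have hbound := norm_leadingCoeff_mul_pow_le hφ hR hsub d k hd0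
      (M := C * ‖T (x c) - T (x c')‖) (fun z hz => by
        have hz' := sphere_subset_closedBall hz
        rw [← heval z (hsub hz')]
        exact hCle _ z (hnorm z hz'))
    have hpow : ρ ^ m ≤ (‖deriv φ a‖ * R) ^ (k : ℕ) :=
      (pow_le_pow_of_le_one hρ0.le (min_le_left _ _) k.2.le).trans
        (pow_le_pow_left₀ hρ0.le (min_le_right _ _) _)
    have h1 : τ * ρ ^ m ≤ C * ‖T (x c) - T (x c')‖ :=
      (mul_le_mul hdk hpow (by positivity) (norm_nonneg _)).trans hbound
    have h2 : 2 * (1 / (2 * C * K) * (ρ / 12) ^ m) = τ * ρ ^ m / C := by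
      rw [hτ, div_pow]
      field_simp
    rw [h2, div_le_iff₀ hC]
    linarith

lemma tendsto_natSqrt_add_one_div :
    Tendsto (fun n : ℕ => ((Nat.sqrt n + 1 : ℕ) : ℝ) / n) atTop (𝓝 0) := by
  have h1 : Tendsto (fun n : ℕ => (√(n : ℝ))⁻¹ + (n : ℝ)⁻¹) atTop (𝓝 0) := by
    have := (tendsto_inv_atTop_zero.comp (Real.tendsto_sqrt_atTop.comp
      (tendsto_natCast_atTop_atTop (R := ℝ)))).add
      (tendsto_inv_atTop_zero.comp (tendsto_natCast_atTop_atTop (R := ℝ)))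
    simpa using this
  refine squeeze_zero (fun n => by positivity) (fun n => ?_) h1
  rw [← one_div √(n : ℝ), ← Real.sqrt_div_self', Nat.cast_add, Nat.cast_one, add_div, one_div]
  gcongr
  exact Real.nat_sqrt_le_real_sqrt

/-- A bound `e_n(T) ≥ c₀ c₁^m` for `n ≤ m²` leaves no exponential decay. -/
lemma one_le_entropyGamma {E F : Type*} [NormedAddCommGroup E] [NormedSpace ℂ E]
    [NormedAddCommGroup F] [NormedSpace ℂ F] {T : E →L[ℂ] F} {c₀ c₁ : ℝ} (h₀ : 0 < c₀)
    (h₁ : 0 < c₁) (h : ∀ m n : ℕ, 0 < n → n ≤ m ^ 2 →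
      ENNReal.ofReal (c₀ * c₁ ^ m) ≤ entropyNumber T n) : 1 ≤ entropyGamma T := by
  have hlim : Tendsto (fun n : ℕ => ENNReal.ofReal (c₀ * c₁ ^ (Nat.sqrt n + 1)) ^ (1 / (n : ℝ)))
      atTop (𝓝 1) := by
    have hexp : Tendsto (fun n : ℕ => Real.exp (Real.log c₀ / n
        + Real.log c₁ * (((Nat.sqrt n + 1 : ℕ) : ℝ) / n))) atTop (𝓝 1) := by
      have := (tendsto_const_div_atTop_nhds_zero_nat (Real.log c₀)).add
        (tendsto_natSqrt_add_one_div.const_mul (Real.log c₁))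
      rw [mul_zero, add_zero] at this
      rw [← Real.exp_zero]
      exact (Real.continuous_exp.tendsto 0).comp this
    have := ENNReal.tendsto_ofReal hexp
    rw [ENNReal.ofReal_one] at this
    refine this.congr fun n => ?_
    have hpos : 0 < c₀ * c₁ ^ (Nat.sqrt n + 1) := by positivity
    rw [ENNReal.ofReal_rpow_of_pos hpos, Real.rpow_def_of_pos hpos,
      Real.log_mul h₀.ne' (by positivity), Real.log_pow]
    congr 2
    ring
  rw [entropyGamma, ← hlim.liminf_eq]
  refine liminf_le_liminf ?_
  filter_upwards [eventually_gt_atTop 0] with n hn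
  gcongr
  exact h _ n hn (by rw [sq]; exact (Nat.lt_succ_sqrt n).le)

end BergmanComp

theorem mainTheorem9 (α : ℝ) [Fact (-1 ≤ α)] (φ : ℂ → ℂ)
    (hφ : DifferentiableOn ℂ φ BergmanComp.disk)
    (hmaps : Set.MapsTo φ BergmanComp.disk BergmanComp.disk)
    (T : BergmanComp.Bergman α →L[ℂ] BergmanComp.Bergman α)
    (hT : BergmanComp.IsCompositionOperator φ T) (hcomp : IsCompactOperator T) :
    BergmanComp.bracket φ ^ (1 / 2 : ℝ) ≤ BergmanComp.entropyGamma T := by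
  by_cases hb : BergmanComp.bracket φ = 0
  · rw [hb, ENNReal.zero_rpow_of_pos (by norm_num)]
    exact zero_le
  · obtain ⟨a, ha, hda⟩ := BergmanComp.exists_deriv_ne_zero_of_bracket_ne_zero hb
    obtain ⟨c₀, c₁, h₀, h₁, h⟩ := BergmanComp.exists_le_entropyNumber hφ hmaps hT ha hda
    exact (ENNReal.rpow_le_one (BergmanComp.bracket_le_one hφ hmaps) (by norm_num)).trans
      (BergmanComp.one_le_entropyGamma h₀ h₁ h)
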